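/- **Theorem.** Work in the language of $\mathrm{ZFA}$ (set theory with atoms), whose non-logical symbols are $\in$ and a constant for the set of atoms. For a set $x$ and $n\in\omega$ let $[x]^n$ be the set of all $n$-element subsets of $x$, and $[x]^{>n}$ the set of all finite subsets of $x$ with more than $n$ elements. Consider the following principles. * $\mathrm{nRC_{fin}}$: for every infinite set $x$ there are an infinite $y\subseteq x$ and a function $f\colon[y]^{>n}\to[y]^n$ with $f(z)\subseteq z$ for all $z\in[y]^{>n}$. * $\mathrm{nC^-_{fin}}$: for every infinite family $\mathcal F$ of finite sets of cardinality greater than $n$ there are an infinite subfamily $\mathcal A\subseteq\mathcal F$ and a function $f\colon\mathcal A\to[\bigcup\mathcal A]^n$ with $f(z)\subseteq z$ for all $z\in\mathcal A$. * $\mathrm{ACF^-}$: every infinite family $\mathcal F$ of non-empty finite sets has an infinite subfamily $\mathcal A\subseteq\mathcal F$ with a choice function $f\colon\mathcal A\to\bigcup\mathcal A$, $f(z)\in z$ for all $z\in\mathcal A$. Let $A$ be a countably infinite set of atoms, and let $\mathrm{BFM}$ be the Basic Fraenkel Model over $A$: the class of hereditarily symmetric elements of the universe of sets over $A$, where $x$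 is symmetric if there is a finite $E\subseteq A$ such that every permutation of $A$ fixing $E$ pointwise fixes $x$. Then: 1. $\mathrm{BFM}$ is a model of $\mathrm{ZFA}$, and $\mathrm{BFM}\models\mathrm{ACF^-}$. 2. $\mathrm{BFM}\models\forall n\in\omega\;\mathrm{nC^-_{fin}}$. 3. $\mathrm{BFM}\models\forall n\in\omega\setminus\{0\}\;\lnot\mathrm{nRC_{fin}}$; more precisely, in $\mathrm{BFM}$ the set of all atoms is infinite, and for every $n\geq 1$ no infinite set $y$ of atoms has a function $f\colon[y]^{>n}\to[y]^n$ with $f(z)\subseteq z$ for all $z\in[y]^{>n}$. 4. Consequently, for every natural number $k\ge 1$, the theory $\mathrm{ZFA}+\forall n\in\omega\;\mathrm{nC^-_{fin}}$ does not imply $\mathrm{kRC_{fin}}$: it has a model in which $\mathrm{kRC_{fin}}$ fails. In particular, over $\mathrm{ZFA}$, $\mathrm{kC^-_{fin}}$ does not imply $\mathrm{kRC_{fin}}$. -/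

import Mathlib

universe u

/-! ## Structures for the language of set theory with atoms -/

/-- A structure for the language of `ZFA`: a binary relation (membership) and a constant
`atomSet` (the set of atoms). -/
class ZFAStructure (M : Type*) where
  mem : M → M → Prop
  atomSet : M

infix:50 " ∈ₐ " => ZFAStructure.mem

/-- The only function symbol of the language of `ZFA`: the constant for the set of atoms. -/
inductive ZFAFunctions : ℕ → Type
  | atomSet : ZFAFunctions 0

/-- The only relation symbol of the language of `ZFA`: membership. -/
inductive ZFARelations : ℕ → Type
  | mem : ZFARelations 2

/-- The first-order language of `ZFA` (equality is part of the logic). -/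
def zfaLanguage : FirstOrder.Language := ⟨ZFAFunctions, ZFARelations⟩

instance zfaLanguageStructure (M : Type*) [ZFAStructure M] : zfaLanguage.Structure M where
  funMap := fun {_} f => match f with
    | ZFAFunctions.atomSet => fun _ => ZFAStructure.atomSet
  RelMap := fun {_} r => match r with
    | ZFARelations.mem => fun v => v 0 ∈ₐ v 1

/-! ## Set-theoretic vocabulary, interpreted in a structure

All quantifiers below range over the elements of the structure `M`, so every predicate is the
interpretation in `M` of a first-order formula in the language of `ZFA`. -/

namespace ZFA

section Vocabulary

variable {M : Type*} [ZFAStructure M]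

/-- `x` is an atom. -/
def IsAtom (x : M) : Prop := x ∈ₐ (ZFAStructure.atomSet : M)

/-- `x` is a set, that is, not an atom. -/
def IsSet (x : M) : Prop := ¬ IsAtom x

/-- `x` is the empty set. -/
def IsEmptySet (x : M) : Prop := IsSet x ∧ ∀ z : M, ¬ z ∈ₐ x

/-- `y` is a set that is a subset of `x`. -/
def IsSubset (y x : M) : Prop := IsSet y ∧ ∀ z : M, z ∈ₐ y → z ∈ₐ x

/-- `p = {x, y}`. -/
def IsUnorderedPair (p x y : M) : Prop := IsSet p ∧ ∀ z : M, z ∈ₐ p ↔ (z = x ∨ z = y)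

/-- `p = (x, y) = {{x}, {x, y}}`. -/
def IsOrderedPair (p x y : M) : Prop :=
  ∃ a b : M, IsUnorderedPair a x x ∧ IsUnorderedPair b x y ∧ IsUnorderedPair p a b

/-- `U = ⋃ F`. -/
def IsUnion (U F : M) : Prop := IsSet U ∧ ∀ w : M, w ∈ₐ U ↔ ∃ z : M, z ∈ₐ F ∧ w ∈ₐ z

/-- `P` is the power set of `x`. -/
def IsPowerSet (P x : M) : Prop := IsSet P ∧ ∀ y : M, y ∈ₐ P ↔ IsSubset y x

/-- The ordered pair `(x, y)` belongs to `f`; for a function `f` this says `f(x) = y`. -/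
def MapsTo (f x y : M) : Prop := ∃ p : M, p ∈ₐ f ∧ IsOrderedPair p x y

/-- `f` is a function from `a` to `b`. -/
def IsFunction (f a b : M) : Prop :=
  IsSet f ∧ (∀ p : M, p ∈ₐ f → ∃ x y : M, x ∈ₐ a ∧ y ∈ₐ b ∧ IsOrderedPair p x y) ∧
    ∀ x : M, x ∈ₐ a → ∃! y : M, MapsTo f x y

/-- `f` is a bijection from `a` to `b`. -/
def IsBijection (f a b : M) : Prop :=
  IsFunction f a b ∧ ∀ y : M, y ∈ₐ b → ∃! x : M, MapsTo f x y

/-- There is a bijection from `a` to `b`. -/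
def Equinumerous (a b : M) : Prop := ∃ f : M, IsBijection f a b

/-- `y = x ∪ {x}`. -/
def IsSuccessor (y x : M) : Prop := IsSet y ∧ ∀ z : M, z ∈ₐ y ↔ (z ∈ₐ x ∨ z = x)

/-- `I` contains the empty set and is closed under successors. -/
def IsInductive (I : M) : Prop :=
  (∃ e : M, e ∈ₐ I ∧ IsEmptySet e) ∧
    ∀ x : M, x ∈ₐ I → ∃ y : M, y ∈ₐ I ∧ IsSuccessor y x

/-- `n ∈ ω`: `n` belongs to every inductive set. -/
def IsNatural (n : M) : Prop := ∀ I : M, IsInductive I → n ∈ₐ I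

/-- `n` is the von Neumann numeral of the natural number `k` of the metatheory. -/
def IsNumeral : ℕ → M → Prop
  | 0, n => IsEmptySet n
  | k + 1, n => ∃ m : M, IsNumeral k m ∧ IsSuccessor n m

/-- `x` is a set with `|x| = n`, for a natural number `n` of the structure. -/
def HasCard (x n : M) : Prop := IsSet x ∧ Equinumerous n x

/-- `x` is a finite set. -/
def IsFinite (x : M) : Prop := IsSet x ∧ ∃ n : M, IsNatural n ∧ HasCard x n

/-- `x` is an infinite set. -/
def IsInfinite (x : M) : Prop := IsSet x ∧ ¬ IsFinite x

/-- `x` is a finite set with `|x| > n` (for von Neumann naturals, `k > n` means `n ∈ k`). -/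
def IsFiniteWithCardGT (x n : M) : Prop := ∃ k : M, IsNatural k ∧ n ∈ₐ k ∧ HasCard x k

/-- `S = [x]ⁿ`, the set of all subsets of `x` of cardinality `n`. -/
def IsSubsetsOfCard (S x n : M) : Prop :=
  IsSet S ∧ ∀ z : M, z ∈ₐ S ↔ (IsSubset z x ∧ HasCard z n)

/-- `S = [x]^{>n}`, the set of all finite subsets of `x` of cardinality greater than `n`. -/
def IsSubsetsOfCardGT (S x n : M) : Prop :=
  IsSet S ∧ ∀ z : M, z ∈ₐ S ↔ (IsSubset z x ∧ IsFiniteWithCardGT z n)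

/-! ## Choice principles -/

/-- The instance of `nRC_fin` at the set `x`: there are an infinite `y ⊆ x` and a function
`f : [y]^{>n} → [y]ⁿ` with `f(z) ⊆ z` for all `z ∈ [y]^{>n}`. -/
def RCFinAt (n x : M) : Prop :=
  ∃ y : M, IsSubset y x ∧ IsInfinite y ∧
    ∃ D R f : M, IsSubsetsOfCardGT D y n ∧ IsSubsetsOfCard R y n ∧ IsFunction f D R ∧
      ∀ z w : M, MapsTo f z w → IsSubset w z

/-- There are an infinite subfamily `B ⊆ F` and a function `f : B → [⋃ B]ⁿ` with `f(z) ⊆ z` for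
all `z ∈ B`. -/
def HasPartialSelection (n F : M) : Prop :=
  ∃ B : M, IsSubset B F ∧ IsInfinite B ∧
    ∃ U R f : M, IsUnion U B ∧ IsSubsetsOfCard R U n ∧ IsFunction f B R ∧
      ∀ z w : M, MapsTo f z w → IsSubset w z

end Vocabulary

section Principles

variable (M : Type*) [ZFAStructure M]

/-- `nRC_fin` holds in `M`. -/
def RCFin (n : M) : Prop := ∀ x : M, IsInfinite x → RCFinAt n x

/-- `nC⁻_fin` holds in `M`: every infinite family of finite sets of cardinality greater than `n`
has an infinite subfamily with an `n`-selection function. -/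
def CFinMinus (n : M) : Prop :=
  ∀ F : M, IsInfinite F → (∀ z : M, z ∈ₐ F → IsFiniteWithCardGT z n) → HasPartialSelection n F

/-- `ACF⁻` holds in `M`: every infinite family of non-empty finite sets has an infinite subfamily
with a choice function. -/
def ACFMinus : Prop :=
  ∀ F : M, IsInfinite F → (∀ z : M, z ∈ₐ F → IsFinite z ∧ ∃ w : M, w ∈ₐ z) →
    ∃ B : M, IsSubset B F ∧ IsInfinite B ∧
      ∃ U f : M, IsUnion U B ∧ IsFunction f B U ∧ ∀ z w : M, MapsTo f z w → w ∈ₐ z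

/-- `M` is a model of `ZFA`. The two schemes range over all first-order formulas of the language
of `ZFA`, with parameters `p` from `M`. -/
structure ModelsZFA : Prop where
  empty : ∃ e : M, IsEmptySet e
  atoms : ∀ a : M, IsAtom a → ∀ z : M, ¬ z ∈ₐ a
  extensionality : ∀ x y : M, IsSet x → IsSet y → (∀ z : M, z ∈ₐ x ↔ z ∈ₐ y) → x = y
  regularity : ∀ x : M, (∃ y : M, y ∈ₐ x) → ∃ y : M, y ∈ₐ x ∧ ∀ z : M, z ∈ₐ x → ¬ z ∈ₐ y
  pairing : ∀ x y : M, ∃ p : M, IsUnorderedPair p x y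
  union : ∀ x : M, ∃ U : M, IsUnion U x
  powerSet : ∀ x : M, ∃ P : M, IsPowerSet P x
  infinity : ∃ I : M, IsInductive I
  separation : ∀ (k : ℕ) (φ : zfaLanguage.Formula (Fin (k + 1))) (p : Fin k → M) (x : M),
    ∃ y : M, IsSet y ∧
      ∀ z : M, z ∈ₐ y ↔ (z ∈ₐ x ∧ φ.Realize (Fin.cons z p : Fin (k + 1) → M))
  replacement : ∀ (k : ℕ) (φ : zfaLanguage.Formula (Fin (k + 2))) (p : Fin k → M) (x : M),
    (∀ z : M, z ∈ₐ x →
      ∃! w : M, φ.Realize (Fin.cons z (Fin.cons w p : Fin (k + 1) → M) : Fin (k + 2) → M)) →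
    ∃ y : M, IsSet y ∧ ∀ w : M, w ∈ₐ y ↔ ∃ z : M, z ∈ₐ x ∧
      φ.Realize (Fin.cons z (Fin.cons w p : Fin (k + 1) → M) : Fin (k + 2) → M)

end Principles

end ZFA

/-! ## The universe of sets over a type of atoms -/

/-- Codes for the sets and atoms of the cumulative hierarchy over the atoms `A`. -/
inductive PreUniverse (A : Type u) : Type (u + 1)
  | atom (a : A) : PreUniverse A
  | set (ι : Type u) (f : ι → PreUniverse A) : PreUniverse A

namespace PreUniverse

variable {A : Type u}

/-- Extensional equality of codes: equal atoms, or sets with the same elements. -/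
def Equiv : PreUniverse A → PreUniverse A → Prop
  | atom a, atom b => a = b
  | set _ f, set _ g => (∀ i, ∃ j, Equiv (f i) (g j)) ∧ ∀ j, ∃ i, Equiv (f i) (g j)
  | atom _, set _ _ => False
  | set _ _, atom _ => False

theorem Equiv.refl (x : PreUniverse A) : Equiv x x := by
  induction x with
  | atom a => simp [Equiv]
  | set ι f ih => exact ⟨fun i => ⟨i, ih i⟩, fun i => ⟨i, ih i⟩⟩

theorem Equiv.symm {x y : PreUniverse A} (h : Equiv x y) : Equiv y x := by
  induction x generalizing y with
  | atom a => cases y with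
    | atom b => simp only [Equiv] at h ⊢; exact h.symm
    | set κ g => simp [Equiv] at h
  | set ι f ih => cases y with
    | atom b => simp [Equiv] at h
    | set κ g =>
      simp only [Equiv] at h ⊢
      refine ⟨fun j => ?_, fun i => ?_⟩
      · obtain ⟨i, hi⟩ := h.2 j
        exact ⟨i, ih i hi⟩
      · obtain ⟨j, hj⟩ := h.1 i
        exact ⟨j, ih i hj⟩

theorem Equiv.trans {x y z : PreUniverse A} (h : Equiv x y) (k : Equiv y z) : Equiv x z := by
  induction x generalizing y z with
  | atom a => cases y with
    | atom b => cases z with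
      | atom c => simp only [Equiv] at h k ⊢; exact Eq.trans h k
      | set κ g => simp [Equiv] at k
    | set κ g => simp [Equiv] at h
  | set ι f ih => cases y with
    | atom b => simp [Equiv] at h
    | set κ g => cases z with
      | atom c => simp [Equiv] at k
      | set l e =>
        simp only [Equiv] at h k ⊢
        refine ⟨fun i => ?_, fun m => ?_⟩
        · obtain ⟨j, hj⟩ := h.1 i
          obtain ⟨m, hm⟩ := k.1 j
          exact ⟨m, ih i hj hm⟩
        · obtain ⟨j, hj⟩ := k.2 m
          obtain ⟨i, hi⟩ := h.2 j
          exact ⟨i, ih i hi hj⟩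

instance setoid (A : Type u) : Setoid (PreUniverse A) :=
  ⟨Equiv, Equiv.refl, Equiv.symm, Equiv.trans⟩

/-- Membership of codes; atoms have no elements. -/
def Mem (x : PreUniverse A) : PreUniverse A → Prop
  | atom _ => False
  | set _ f => ∃ i, Equiv x (f i)

theorem Mem.congr {x x' y y' : PreUniverse A} (hx : Equiv x x') (hy : Equiv y y')
    (h : Mem x y) : Mem x' y' := by
  cases y with
  | atom a => exact h.elim
  | set ι f => cases y' with
    | atom b => simp [Equiv] at hy
    | set κ g =>
      obtain ⟨i, hi⟩ := h
      simp only [Equiv] at hy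
      obtain ⟨j, hj⟩ := hy.1 i
      exact ⟨j, (hx.symm.trans hi).trans hj⟩

/-- The action of a permutation of the atoms on codes. -/
def act (π : Equiv.Perm A) : PreUniverse A → PreUniverse A
  | atom a => atom (π a)
  | set ι f => set ι fun i => act π (f i)

theorem act_congr (π : Equiv.Perm A) {x y : PreUniverse A} (h : Equiv x y) :
    Equiv (act π x) (act π y) := by
  induction x generalizing y with
  | atom a => cases y with
    | atom b => simp only [Equiv, act] at h ⊢; rw [h]
    | set κ g => simp [Equiv] at h
  | set ι f ih => cases y with
    | atom b => simp [Equiv] at h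
    | set κ g =>
      simp only [Equiv, act] at h ⊢
      refine ⟨fun i => ?_, fun j => ?_⟩
      · obtain ⟨j, hj⟩ := h.1 i
        exact ⟨j, ih i hj⟩
      · obtain ⟨i, hi⟩ := h.2 j
        exact ⟨i, ih i hi⟩

end PreUniverse

/-- The universe of sets over the atoms `A` (with full choice): codes modulo extensional
equality. -/
def AtomUniverse (A : Type u) : Type (u + 1) := Quotient (PreUniverse.setoid A)

namespace AtomUniverse

variable {A : Type u}

/-- Membership. -/
def Mem : AtomUniverse A → AtomUniverse A → Prop :=
  Quotient.lift₂ PreUniverse.Mem fun _ _ _ _ hx hy =>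
    propext ⟨PreUniverse.Mem.congr hx hy, PreUniverse.Mem.congr hx.symm hy.symm⟩

/-- The atom `a`. -/
def atom (a : A) : AtomUniverse A := Quotient.mk _ (PreUniverse.atom a)

/-- The set of all atoms. -/
def atomSet (A : Type u) : AtomUniverse A := Quotient.mk _ (PreUniverse.set A PreUniverse.atom)

/-- The action of a permutation of the atoms on the universe: `π x = {π y : y ∈ x}` for sets. -/
def act (π : Equiv.Perm A) : AtomUniverse A → AtomUniverse A :=
  Quotient.map (PreUniverse.act π) fun _ _ h => PreUniverse.act_congr π h

/-- `E` supports `x`: every permutation of the atoms that fixes `E` pointwise fixes `x`. -/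
def Supports (E : Set A) (x : AtomUniverse A) : Prop :=
  ∀ π : Equiv.Perm A, (∀ a ∈ E, π a = a) → act π x = x

/-- `x` is symmetric with respect to the group of all permutations of the atoms and the normal
filter generated by the ideal of finite sets of atoms. -/
def IsSymmetric (x : AtomUniverse A) : Prop := ∃ E : Set A, E.Finite ∧ Supports E x

/-- `x` is hereditarily symmetric: `x` is symmetric and all its elements are hereditarily
symmetric. -/
inductive IsHereditarilySymmetric : AtomUniverse A → Prop
  | intro (x : AtomUniverse A) (hx : IsSymmetric x)
      (h : ∀ y : AtomUniverse A, Mem y x → IsHereditarilySymmetric y) :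
      IsHereditarilySymmetric x

theorem isHereditarilySymmetric_atom (a : A) : IsHereditarilySymmetric (atom a) := by
  refine ⟨_, ⟨{a}, Set.finite_singleton a, fun π hπ => ?_⟩, fun y hy => ?_⟩
  · change Quotient.mk _ (PreUniverse.atom (π a)) = Quotient.mk _ (PreUniverse.atom a)
    rw [hπ a rfl]
  · induction y using Quotient.inductionOn with
    | h y => exact (hy : PreUniverse.Mem y (PreUniverse.atom a)).elim

theorem isHereditarilySymmetric_atomSet (A : Type u) : IsHereditarilySymmetric (atomSet A) := by
  refine ⟨_, ⟨∅, Set.finite_empty, fun π _ => ?_⟩, fun y hy => ?_⟩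
  · refine Quotient.sound (s := PreUniverse.setoid A) ?_
    exact ⟨fun a => ⟨π a, PreUniverse.Equiv.refl _⟩,
      fun a => ⟨π.symm a, by simp [PreUniverse.act, PreUniverse.Equiv]⟩⟩
  · induction y using Quotient.inductionOn with
    | h y =>
      obtain ⟨a, ha⟩ := (hy : PreUniverse.Mem y (PreUniverse.set A PreUniverse.atom))
      have e : (Quotient.mk _ y : AtomUniverse A) = atom a := Quotient.sound ha
      rw [e]
      exact isHereditarilySymmetric_atom a

end AtomUniverse

/-! ## The Basic Fraenkel Model -/

/-- The Basic Fraenkel Model with atoms `A`: the hereditarily symmetric elements of the universe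
over `A`, with the membership relation and the set of atoms of that universe. -/
def BasicFraenkelModel (A : Type u) : Type (u + 1) :=
  {x : AtomUniverse A // AtomUniverse.IsHereditarilySymmetric x}

instance basicFraenkelStructure (A : Type u) : ZFAStructure (BasicFraenkelModel A) where
  mem x y := AtomUniverse.Mem x.1 y.1
  atomSet := ⟨AtomUniverse.atomSet A, AtomUniverse.isHereditarilySymmetric_atomSet A⟩

/-! Permutations of the atoms are automorphisms of the model, so a class defined from parameters is
invariant under every permutation that fixes supports of the parameters. By comprehension
(`exists_set`), a small class with a finite support is a set of the model; this yields the axioms of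
ZFA. The naturals of the model are exactly the standard numerals `num k`, fixed by all permutations,
and every finite class is a set, so finiteness and finite cardinality are absolute and the choice
principles become statements about `elements`.

Both positive principles come from `exists_partial_uniformization`. Every element has a least finite
support, and a finite support of a finite set supports each of its elements (`Supports.of_mem`).
Hence a selection `w` from a finite `z` is supported wherever `z` is. Let `E` support the family
`F`. If infinitely many members of `F` are supported by `E`, any external selection on them is
itself supported by `E`. Otherwise some `z` in `F` has an atom `a` of its least support outside `E`.
The permutations fixing `E` and the rest of that support move `z` through an infinite orbit. Here `π
• z ↦ π • w` is well defined: if such a permutation fixes `z`, it preserves the least support, so it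
fixes `a` and therefore `w`.

Ramsey choice fails at the atoms. Given `f` with support `E`, take `k + 1` atoms of `y` outside `E`
as `z`. Since `1 ≤ k`, the set `f(z)` is nonempty and proper in `z`; swapping an atom inside it with
one outside it fixes `f` and `z` but moves `f(z)`. -/

namespace AtomUniverse

variable {A : Type u}

/-! ### The group action and extensionality in the full universe -/

theorem act_one (x : AtomUniverse A) : act 1 x = x := by
  induction x using Quotient.inductionOn with
  | h x =>
    refine congrArg (Quotient.mk _) ?_
    induction x with
    | atom a => rfl
    | set ι f ih => simp only [PreUniverse.act, ih]

theorem act_mul (π σ : Equiv.Perm A) (x : AtomUniverse A) : act (π * σ) x = act π (act σ x) := by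
  induction x using Quotient.inductionOn with
  | h x =>
    refine congrArg (Quotient.mk _) ?_
    induction x with
    | atom a => rfl
    | set ι f ih => simp only [PreUniverse.act, ih]

theorem mem_act_act (π : Equiv.Perm A) {x y : AtomUniverse A} (h : Mem x y) :
    Mem (act π x) (act π y) := by
  induction x using Quotient.inductionOn with
  | h x =>
    induction y using Quotient.inductionOn with
    | h y =>
      cases y with
      | atom a => exact (h : PreUniverse.Mem x (PreUniverse.atom a)).elim
      | set ι f =>
        obtain ⟨i, hi⟩ := (h : PreUniverse.Mem x (PreUniverse.set ι f))
        exact ⟨i, PreUniverse.act_congr π hi⟩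

theorem act_atom (π : Equiv.Perm A) (a : A) : act π (atom a) = atom (π a) := rfl

theorem atom_injective : Function.Injective (atom : A → AtomUniverse A) :=
  fun _ _ h => Quotient.exact h

theorem not_mem_atom (x : AtomUniverse A) (a : A) : ¬ Mem x (atom a) := by
  induction x using Quotient.inductionOn with
  | h x => exact fun h => (h : PreUniverse.Mem x (PreUniverse.atom a)).elim

/-- The set of the values of a family indexed by a small type. -/
noncomputable def ofFamily {ι : Type u} (f : ι → AtomUniverse A) : AtomUniverse A :=
  Quotient.mk _ (PreUniverse.set ι fun i => (f i).out)

theorem mem_ofFamily {ι : Type u} (f : ι → AtomUniverse A) (x : AtomUniverse A) :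
    Mem x (ofFamily f) ↔ ∃ i, x = f i := by
  induction x using Quotient.inductionOn with
  | h x =>
    refine exists_congr fun i => ⟨fun h => ?_, fun h => ?_⟩
    · exact (Quotient.sound (s := PreUniverse.setoid A) h).trans (f i).out_eq
    · exact Quotient.exact (s := PreUniverse.setoid A) (h.trans (f i).out_eq.symm)

theorem eq_atom_or_ofFamily (x : AtomUniverse A) :
    (∃ a, x = atom a) ∨ ∃ (ι : Type u) (f : ι → AtomUniverse A), x = ofFamily f := by
  induction x using Quotient.inductionOn with
  | h x =>
    cases x with
    | atom a => exact Or.inl ⟨a, rfl⟩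
    | set ι f =>
      refine Or.inr ⟨ι, fun i => Quotient.mk _ (f i), Quotient.sound ?_⟩
      exact ⟨fun i => ⟨i, (Quotient.mk_out (s := PreUniverse.setoid A) (f i)).symm⟩,
        fun i => ⟨i, (Quotient.mk_out (s := PreUniverse.setoid A) (f i)).symm⟩⟩

theorem ofFamily_ne_atom {ι : Type u} (f : ι → AtomUniverse A) (a : A) : ofFamily f ≠ atom a := by
  intro h
  have h' := Quotient.exact (s := PreUniverse.setoid A) h
  change PreUniverse.Equiv _ _ at h'
  simp [PreUniverse.Equiv] at h'

theorem ofFamily_ext {ι κ : Type u} (f : ι → AtomUniverse A) (g : κ → AtomUniverse A)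
    (h : ∀ z, Mem z (ofFamily f) ↔ Mem z (ofFamily g)) : ofFamily f = ofFamily g := by
  refine Quotient.sound (s := PreUniverse.setoid A) ⟨fun i => ?_, fun j => ?_⟩
  · obtain ⟨j, hj⟩ := (mem_ofFamily g _).1 ((h (f i)).1 ((mem_ofFamily f _).2 ⟨i, rfl⟩))
    exact ⟨j, Quotient.exact (s := PreUniverse.setoid A)
      ((f i).out_eq.trans (hj.trans (g j).out_eq.symm))⟩
  · obtain ⟨i, hi⟩ := (mem_ofFamily f _).1 ((h (g j)).2 ((mem_ofFamily g _).2 ⟨j, rfl⟩))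
    exact ⟨i, Quotient.exact (s := PreUniverse.setoid A)
      ((f i).out_eq.trans (hi.symm.trans (g j).out_eq.symm))⟩

theorem ext_of_ne_atom {x y : AtomUniverse A} (hx : ∀ a, x ≠ atom a) (hy : ∀ a, y ≠ atom a)
    (h : ∀ z, Mem z x ↔ Mem z y) : x = y := by
  rcases eq_atom_or_ofFamily x with ⟨a, ha⟩ | ⟨ι, f, rfl⟩
  · exact (hx a ha).elim
  rcases eq_atom_or_ofFamily y with ⟨a, ha⟩ | ⟨κ, g, rfl⟩
  · exact (hy a ha).elim
  exact ofFamily_ext f g h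

theorem mem_atomSet (x : AtomUniverse A) : Mem x (atomSet A) ↔ ∃ a, x = atom a := by
  induction x using Quotient.inductionOn with
  | h x =>
    exact exists_congr fun a => ⟨fun h => Quotient.sound (s := PreUniverse.setoid A) h,
      fun h => Quotient.exact (s := PreUniverse.setoid A) h⟩

/-- A code lists its elements by a type in `u`, although the universe itself lives one level up;
smallness plays the part of "is a set, not a proper class". -/
theorem small_setOf_mem (x : AtomUniverse A) : Small.{u} {z | Mem z x} := by
  rcases eq_atom_or_ofFamily x with ⟨a, rfl⟩ | ⟨ι, f, rfl⟩
  · have : {z | Mem z (atom a)} = ∅ := Set.eq_empty_of_forall_notMem fun z => not_mem_atom z a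
    rw [this]
    infer_instance
  · have : {z | Mem z (ofFamily f)} = Set.range f :=
      Set.ext fun z => (mem_ofFamily f z).trans (exists_congr fun _ => eq_comm)
    rw [this]
    infer_instance

theorem act_inv_act (π : Equiv.Perm A) (x : AtomUniverse A) : act π⁻¹ (act π x) = x := by
  rw [← act_mul, inv_mul_cancel, act_one]

theorem act_act_inv (π : Equiv.Perm A) (x : AtomUniverse A) : act π (act π⁻¹ x) = x := by
  rw [← act_mul, mul_inv_cancel, act_one]

theorem Supports.act {E : Set A} {x : AtomUniverse A} (h : Supports E x) (π : Equiv.Perm A) :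
    Supports (π '' E) (AtomUniverse.act π x) := by
  intro σ hσ
  have := h (π⁻¹ * σ * π) fun a ha => by
    simp [hσ (π a) (Set.mem_image_of_mem π ha)]
  rw [act_mul, act_mul] at this
  rw [← act_act_inv π (AtomUniverse.act σ _), this]

theorem IsHereditarilySymmetric.act {x : AtomUniverse A} (h : IsHereditarilySymmetric x)
    (π : Equiv.Perm A) : IsHereditarilySymmetric (AtomUniverse.act π x) := by
  induction h with
  | intro x hx h ih =>
    obtain ⟨E, hE, hEx⟩ := hx
    refine ⟨_, ⟨_, hE.image π, hEx.act π⟩, fun y hy => ?_⟩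
    have := ih _ (act_inv_act π x ▸ mem_act_act π⁻¹ hy)
    rwa [act_act_inv] at this

end AtomUniverse

namespace BasicFraenkelModel

open ZFA

variable {A : Type u}

/-! ### The model: action, supports and comprehension -/

noncomputable instance : MulAction (Equiv.Perm A) (BasicFraenkelModel A) where
  smul π x := ⟨AtomUniverse.act π x.1, x.2.act π⟩
  one_smul x := Subtype.ext (AtomUniverse.act_one x.1)
  mul_smul π σ x := Subtype.ext (AtomUniverse.act_mul π σ x.1)

/-- An atom, as an element of the model. -/
def atom (a : A) : BasicFraenkelModel A :=
  ⟨AtomUniverse.atom a, AtomUniverse.isHereditarilySymmetric_atom a⟩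

theorem smul_atom (π : Equiv.Perm A) (a : A) : π • atom a = atom (π a) := rfl

theorem atom_injective : Function.Injective (atom : A → BasicFraenkelModel A) :=
  fun _ _ h => AtomUniverse.atom_injective (congrArg Subtype.val h)

theorem isAtom_iff (x : BasicFraenkelModel A) : IsAtom x ↔ ∃ a, x = atom a :=
  (AtomUniverse.mem_atomSet x.1).trans
    (exists_congr fun _ => ⟨fun h => Subtype.ext h, fun h => congrArg Subtype.val h⟩)

theorem not_mem_atom (x : BasicFraenkelModel A) (a : A) : ¬ x ∈ₐ atom a :=
  AtomUniverse.not_mem_atom x.1 a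

@[simp]
theorem smul_mem_smul_iff (π : Equiv.Perm A) {x y : BasicFraenkelModel A} :
    π • x ∈ₐ π • y ↔ x ∈ₐ y := by
  refine ⟨fun h => ?_, fun h => AtomUniverse.mem_act_act π h⟩
  have h' : π⁻¹ • π • x ∈ₐ π⁻¹ • π • y := AtomUniverse.mem_act_act π⁻¹ h
  rwa [inv_smul_smul, inv_smul_smul] at h'

theorem mem_smul_iff (π : Equiv.Perm A) {x y : BasicFraenkelModel A} :
    x ∈ₐ π • y ↔ π⁻¹ • x ∈ₐ y := by
  rw [← smul_mem_smul_iff π (x := π⁻¹ • x), smul_inv_smul]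

@[simp]
theorem isSet_smul_iff (π : Equiv.Perm A) {x : BasicFraenkelModel A} :
    IsSet (π • x) ↔ IsSet x := by
  refine not_congr ?_
  rw [isAtom_iff, isAtom_iff]
  constructor
  · rintro ⟨a, ha⟩
    exact ⟨π⁻¹ a, by rw [← smul_atom, ← ha, inv_smul_smul]⟩
  · rintro ⟨a, rfl⟩
    exact ⟨π a, rfl⟩

theorem mem_isSet {x y : BasicFraenkelModel A} (h : x ∈ₐ y) : IsSet y := by
  intro hy
  obtain ⟨a, rfl⟩ := (isAtom_iff y).1 hy
  exact not_mem_atom x a h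

/-- The model is transitive in the full universe, so comparing the elements that lie in the model
loses nothing. -/
theorem ext_of_isSet {x y : BasicFraenkelModel A} (hx : IsSet x) (hy : IsSet y)
    (h : ∀ z, z ∈ₐ x ↔ z ∈ₐ y) : x = y := by
  refine Subtype.ext (AtomUniverse.ext_of_ne_atom (fun a ha => hx ?_) (fun a ha => hy ?_) ?_)
  · exact (isAtom_iff x).2 ⟨a, Subtype.ext ha⟩
  · exact (isAtom_iff y).2 ⟨a, Subtype.ext ha⟩
  · intro z
    refine ⟨fun hz => ?_, fun hz => ?_⟩
    · obtain ⟨x, ⟨_, _, hx'⟩⟩ := x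
      exact (h ⟨z, hx' z hz⟩).1 hz
    · obtain ⟨y, ⟨_, _, hy'⟩⟩ := y
      exact (h ⟨z, hy' z hz⟩).2 hz

theorem wellFounded_mem :
    WellFounded (ZFAStructure.mem : BasicFraenkelModel A → BasicFraenkelModel A → Prop) := by
  refine ⟨fun ⟨x, hx⟩ => ?_⟩
  induction hx with
  | intro x hx h ih => exact ⟨_, fun y hy => ih y.1 hy⟩

/-- `E` supports the element `x` of the model. -/
def Supports (E : Set A) (x : BasicFraenkelModel A) : Prop :=
  ∀ π : Equiv.Perm A, (∀ a ∈ E, π a = a) → π • x = x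

theorem Supports.mono {E F : Set A} {x : BasicFraenkelModel A} (h : Supports E x) (hEF : E ⊆ F) :
    Supports F x := fun π hπ => h π fun a ha => hπ a (hEF ha)

theorem Supports.smul {E : Set A} {x : BasicFraenkelModel A} (h : Supports E x)
    (π : Equiv.Perm A) : Supports (π '' E) (π • x) := fun σ hσ =>
  Subtype.ext (AtomUniverse.Supports.act (fun τ hτ => congrArg Subtype.val (h τ hτ)) π σ hσ)

theorem exists_supports (x : BasicFraenkelModel A) : ∃ E : Set A, E.Finite ∧ Supports E x := by
  obtain ⟨x, ⟨_, ⟨E, hE, hx⟩, h⟩⟩ := x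
  exact ⟨E, hE, fun π hπ => Subtype.ext (hx π hπ)⟩

/-- `E` supports the class `S`: the class is closed under the permutations that fix `E`
pointwise. -/
def SupportsClass (E : Set A) (S : Set (BasicFraenkelModel A)) : Prop :=
  ∀ π : Equiv.Perm A, (∀ a ∈ E, π a = a) → ∀ z ∈ S, π • z ∈ S

/-- The elements of `x`. -/
def elements (x : BasicFraenkelModel A) : Set (BasicFraenkelModel A) := {z | z ∈ₐ x}

@[simp]
theorem mem_elements {x z : BasicFraenkelModel A} : z ∈ elements x ↔ z ∈ₐ x := Iff.rfl

instance small_elements (x : BasicFraenkelModel A) : Small.{u} (elements x) := by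
  have := AtomUniverse.small_setOf_mem x.1
  refine small_of_injective (β := {z | AtomUniverse.Mem z x.1}) (f := fun z => ⟨z.1.1, z.2⟩) ?_
  intro z w h
  exact Subtype.ext (Subtype.ext (Subtype.mk.inj h))

theorem elements_smul (π : Equiv.Perm A) (x : BasicFraenkelModel A) :
    elements (π • x) = (fun z => π • z) '' elements x := by
  ext z
  simp only [mem_elements, Set.mem_image, mem_smul_iff]
  exact ⟨fun h => ⟨_, h, smul_inv_smul π z⟩, by rintro ⟨w, hw, rfl⟩; rwa [inv_smul_smul]⟩

theorem Supports.smul_mem {E : Set A} {x z : BasicFraenkelModel A} (h : Supports E x)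
    {π : Equiv.Perm A} (hπ : ∀ a ∈ E, π a = a) (hz : z ∈ₐ x) : π • z ∈ₐ x := by
  have := (smul_mem_smul_iff π).2 hz
  rwa [h π hπ] at this

theorem inv_fixes {E : Set A} {π : Equiv.Perm A} (hπ : ∀ a ∈ E, π a = a) :
    ∀ a ∈ E, π⁻¹ a = a := fun a ha => by
  rw [Equiv.Perm.inv_eq_iff_eq, hπ a ha]

/-- Comprehension: a small class with a finite support is a set of the model. -/
theorem exists_set (S : Set (BasicFraenkelModel A)) [Small.{u} S] {E : Set A} (hE : E.Finite)
    (hS : SupportsClass E S) :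
    ∃ x : BasicFraenkelModel A, IsSet x ∧ (∀ z, z ∈ₐ x ↔ z ∈ S) ∧ Supports E x := by
  let f : Shrink.{u} S → AtomUniverse A := fun i => ((equivShrink S).symm i).1.1
  have hf : ∀ z, AtomUniverse.Mem z (AtomUniverse.ofFamily f) ↔ ∃ s ∈ S, z = s.1 := by
    intro z
    rw [AtomUniverse.mem_ofFamily]
    constructor
    · rintro ⟨i, rfl⟩
      exact ⟨_, ((equivShrink S).symm i).2, rfl⟩
    · rintro ⟨s, hs, rfl⟩
      exact ⟨equivShrink S ⟨s, hs⟩, by simp [f]⟩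
  have hfs : AtomUniverse.Supports E (AtomUniverse.ofFamily f) := by
    intro π hπ
    refine AtomUniverse.ext_of_ne_atom (fun a ha => ?_) (AtomUniverse.ofFamily_ne_atom f)
      fun z => ⟨fun hz => ?_, fun hz => ?_⟩
    · refine AtomUniverse.ofFamily_ne_atom f (π⁻¹ a) ?_
      rw [← AtomUniverse.act_atom, ← ha, AtomUniverse.act_inv_act]
    · have := AtomUniverse.mem_act_act π⁻¹ hz
      rw [AtomUniverse.act_inv_act] at this
      obtain ⟨s, hs, hzs⟩ := (hf _).1 this
      refine (hf z).2 ⟨π • s, hS π hπ s hs, ?_⟩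
      rw [← AtomUniverse.act_act_inv π z, hzs]
      rfl
    · obtain ⟨s, hs, rfl⟩ := (hf z).1 hz
      have h1 := (hf _).2 ⟨_, hS π⁻¹ (inv_fixes hπ) s hs, rfl⟩
      have h2 := AtomUniverse.mem_act_act π h1
      rwa [show AtomUniverse.act π (π⁻¹ • s).1 = s.1 from AtomUniverse.act_act_inv π s.1] at h2
  refine ⟨⟨AtomUniverse.ofFamily f, _, ⟨E, hE, hfs⟩, fun y hy => ?_⟩, ?_, fun z => ?_, ?_⟩
  · obtain ⟨s, hs, rfl⟩ := (hf y).1 hy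
    exact s.2
  · intro h
    obtain ⟨a, ha⟩ := (isAtom_iff _).1 h
    exact AtomUniverse.ofFamily_ne_atom f a (congrArg Subtype.val ha)
  · refine (hf z.1).trans ⟨?_, fun h => ⟨z, h, rfl⟩⟩
    rintro ⟨s, hs, h⟩
    rwa [Subtype.ext h]
  · exact fun π hπ => Subtype.ext (hfs π hπ)

theorem exists_common_support {ι : Type*} [Finite ι] (p : ι → BasicFraenkelModel A) :
    ∃ E : Set A, E.Finite ∧ ∀ i, Supports E (p i) := by
  choose E hE hp using fun i => exists_supports (p i)
  exact ⟨⋃ i, E i, Set.finite_iUnion hE, fun i => (hp i).mono (Set.subset_iUnion E i)⟩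

/-- Every finite class is a set of the model. -/
theorem exists_set_of_finite (S : Set (BasicFraenkelModel A)) (hS : S.Finite) :
    ∃ x : BasicFraenkelModel A, IsSet x ∧ ∀ z, z ∈ₐ x ↔ z ∈ S := by
  have := hS.to_subtype
  obtain ⟨E, hE, h⟩ := exists_common_support (fun s : S => s.1)
  obtain ⟨x, hx, hxS, -⟩ := exists_set S hE fun π hπ z hz => by
    rw [h ⟨z, hz⟩ π hπ]
    exact hz
  exact ⟨x, hx, hxS⟩

/-- Every permutation of the atoms is an automorphism of the model. -/
noncomputable def automorphism (π : Equiv.Perm A) :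
    zfaLanguage.Equiv (BasicFraenkelModel A) (BasicFraenkelModel A) where
  toEquiv := MulAction.toPerm π
  map_fun' := by
    rintro n ⟨⟩ x
    change π • (ZFAStructure.atomSet : BasicFraenkelModel A) = ZFAStructure.atomSet
    have hs : IsSet (ZFAStructure.atomSet : BasicFraenkelModel A) := fun h => by
      obtain ⟨a, ha⟩ := (isAtom_iff _).1 h
      obtain ⟨b, hb⟩ := (isAtom_iff (ZFAStructure.atomSet : BasicFraenkelModel A)).1 h
      have : atom a ∈ₐ (ZFAStructure.atomSet : BasicFraenkelModel A) :=
        (isAtom_iff _).2 ⟨a, rfl⟩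
      rw [hb] at this
      exact not_mem_atom _ _ this
    refine ext_of_isSet ((isSet_smul_iff π).2 hs) hs fun z => ?_
    rw [mem_smul_iff]
    change ZFA.IsAtom _ ↔ ZFA.IsAtom _
    exact not_iff_not.1 (isSet_smul_iff π⁻¹)
  map_rel' := by
    rintro n ⟨⟩ x
    exact smul_mem_smul_iff π

/-- Automorphisms preserve truth of formulas; this is what makes the separation and replacement
classes finitely supported. -/
theorem realize_smul (π : Equiv.Perm A) {α : Type*} (φ : zfaLanguage.Formula α)
    (v : α → BasicFraenkelModel A) : φ.Realize (fun i => π • v i) ↔ φ.Realize v :=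
  FirstOrder.Language.StrongHomClass.realize_formula (automorphism π) φ

/-! ### The axioms of `ZFA` -/

theorem isSubset_iff {x y : BasicFraenkelModel A} :
    IsSubset y x ↔ IsSet y ∧ elements y ⊆ elements x := Iff.rfl

theorem isSubset_smul_iff (π : Equiv.Perm A) {x y : BasicFraenkelModel A} :
    IsSubset (π • y) (π • x) ↔ IsSubset y x := by
  rw [isSubset_iff, isSubset_iff, isSet_smul_iff, elements_smul, elements_smul,
    Set.image_subset_image_iff (MulAction.injective π)]

theorem exists_isUnorderedPair (x y : BasicFraenkelModel A) : ∃ p, IsUnorderedPair p x y := by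
  obtain ⟨p, hp, h⟩ := exists_set_of_finite {x, y} (Set.toFinite _)
  exact ⟨p, hp, h⟩

theorem exists_isUnion (x : BasicFraenkelModel A) : ∃ U, IsUnion U x := by
  obtain ⟨E, hE, hx⟩ := exists_supports x
  obtain ⟨U, hU, h, -⟩ := exists_set (⋃ z : elements x, elements z.1) hE fun π hπ w hw => by
    obtain ⟨⟨z, hz⟩, hw⟩ := Set.mem_iUnion.1 hw
    exact Set.mem_iUnion.2 ⟨⟨π • z, hx.smul_mem hπ hz⟩, (smul_mem_smul_iff π).2 hw⟩
  refine ⟨U, hU, fun w => (h w).trans ?_⟩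
  simp

/-- A subset is determined by its trace on the small type `elements x`. -/
theorem small_setOf_isSubset (x : BasicFraenkelModel A) : Small.{u} {y | IsSubset y x} := by
  refine small_of_injective (β := Set (elements x)) (f := fun y => {z | z.1 ∈ₐ y.1}) ?_
  intro y z h
  refine Subtype.ext (ext_of_isSet y.2.1 z.2.1 fun w => ⟨fun hw => ?_, fun hw => ?_⟩)
  · exact (Set.ext_iff.1 h ⟨w, y.2.2 w hw⟩).1 hw
  · exact (Set.ext_iff.1 h ⟨w, z.2.2 w hw⟩).2 hw

/-- A class of subsets of `x` that is closed under the permutations fixing `x` is a set. -/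
theorem exists_set_of_subsets (x : BasicFraenkelModel A) {Q : BasicFraenkelModel A → Prop}
    (hQ : ∀ (π : Equiv.Perm A) z, Q z → Q (π • z)) :
    ∃ S, IsSet S ∧ ∀ z, z ∈ₐ S ↔ IsSubset z x ∧ Q z := by
  obtain ⟨E, hE, hx⟩ := exists_supports x
  have := small_setOf_isSubset x
  have : Small.{u} {z | IsSubset z x ∧ Q z} :=
    small_subset (s := {y | IsSubset y x}) fun _ (h : _ ∧ _) => h.1
  obtain ⟨S, hS, h, -⟩ := exists_set {z | IsSubset z x ∧ Q z} hE fun π hπ z hz => by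
    refine ⟨?_, hQ π z hz.2⟩
    rw [← hx π hπ]
    exact (isSubset_smul_iff π).2 hz.1
  exact ⟨S, hS, h⟩

theorem exists_isPowerSet (x : BasicFraenkelModel A) : ∃ P, IsPowerSet P x := by
  obtain ⟨P, hP, h⟩ := exists_set_of_subsets x (Q := fun _ => True) fun _ _ h => h
  exact ⟨P, hP, fun y => (h y).trans (and_iff_left trivial)⟩

theorem exists_isEmptySet : ∃ e : BasicFraenkelModel A, IsEmptySet e := by
  obtain ⟨e, he, h⟩ := exists_set_of_finite (∅ : Set (BasicFraenkelModel A)) Set.finite_empty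
  exact ⟨e, he, fun z hz => (h z).1 hz⟩

instance : Nonempty (BasicFraenkelModel A) := exists_isEmptySet.nonempty

theorem exists_isSuccessor (x : BasicFraenkelModel A) : ∃ y, IsSuccessor y x := by
  obtain ⟨E, hE, hx⟩ := exists_supports x
  have : Small.{u} ((elements x ∪ {x} : Set (BasicFraenkelModel A))) := by infer_instance
  obtain ⟨y, hy, h, -⟩ := exists_set (elements x ∪ {x}) hE fun π hπ z hz => by
    rcases hz with hz | rfl
    · exact Or.inl (hx.smul_mem hπ hz)
    · exact Or.inr (hx π hπ)
  exact ⟨y, hy, h⟩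

theorem realize_cons_of_supports {k : ℕ} (φ : zfaLanguage.Formula (Fin (k + 1)))
    {p : Fin k → BasicFraenkelModel A} {π : Equiv.Perm A} (hp : ∀ i, π • p i = p i)
    (z : BasicFraenkelModel A) :
    φ.Realize (Fin.cons (π • z) p : Fin (k + 1) → BasicFraenkelModel A) ↔
      φ.Realize (Fin.cons z p : Fin (k + 1) → BasicFraenkelModel A) := by
  rw [← realize_smul π φ (Fin.cons z p)]
  refine iff_of_eq (congrArg _ (funext fun i => ?_))
  cases i using Fin.cases with
  | zero => rfl
  | succ i => exact (hp i).symm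

theorem realize_cons_cons_of_supports {k : ℕ} (φ : zfaLanguage.Formula (Fin (k + 2)))
    {p : Fin k → BasicFraenkelModel A} {π : Equiv.Perm A} (hp : ∀ i, π • p i = p i)
    (z w : BasicFraenkelModel A) :
    φ.Realize (Fin.cons (π • z) (Fin.cons (π • w) p : Fin (k + 1) → BasicFraenkelModel A) :
        Fin (k + 2) → BasicFraenkelModel A) ↔
      φ.Realize (Fin.cons z (Fin.cons w p : Fin (k + 1) → BasicFraenkelModel A) :
        Fin (k + 2) → BasicFraenkelModel A) := by
  rw [← realize_smul π φ (Fin.cons z (Fin.cons w p : Fin (k + 1) → BasicFraenkelModel A))]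
  refine iff_of_eq (congrArg _ (funext fun i => ?_))
  cases i using Fin.cases with
  | zero => rfl
  | succ i =>
    cases i using Fin.cases with
    | zero => rfl
    | succ i => exact (hp i).symm

theorem exists_separation {k : ℕ} (φ : zfaLanguage.Formula (Fin (k + 1)))
    (p : Fin k → BasicFraenkelModel A) (x : BasicFraenkelModel A) :
    ∃ y, IsSet y ∧ ∀ z, z ∈ₐ y ↔
      (z ∈ₐ x ∧ φ.Realize (Fin.cons z p : Fin (k + 1) → BasicFraenkelModel A)) := by
  obtain ⟨E, hE, hx⟩ := exists_supports x
  obtain ⟨F, hF, hp⟩ := exists_common_support p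
  let S : Set (BasicFraenkelModel A) := {z | z ∈ₐ x ∧
    φ.Realize (Fin.cons z p : Fin (k + 1) → BasicFraenkelModel A)}
  have : Small.{u} S := small_subset (s := elements x) (t := S) fun _ (h : _ ∧ _) => h.1
  obtain ⟨y, hy, h, -⟩ := exists_set S (hE.union hF) fun π hπ z hz =>
    ⟨hx.smul_mem (fun a ha => hπ a (Or.inl ha)) hz.1,
      (realize_cons_of_supports φ (fun i => hp i π fun a ha => hπ a (Or.inr ha)) z).2 hz.2⟩
  exact ⟨y, hy, h⟩

theorem exists_replacement {k : ℕ} (φ : zfaLanguage.Formula (Fin (k + 2)))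
    (p : Fin k → BasicFraenkelModel A) (x : BasicFraenkelModel A)
    (hφ : ∀ z, z ∈ₐ x → ∃! w, φ.Realize
      (Fin.cons z (Fin.cons w p : Fin (k + 1) → BasicFraenkelModel A) :
        Fin (k + 2) → BasicFraenkelModel A)) :
    ∃ y, IsSet y ∧ ∀ w, w ∈ₐ y ↔ ∃ z, z ∈ₐ x ∧ φ.Realize
      (Fin.cons z (Fin.cons w p : Fin (k + 1) → BasicFraenkelModel A) :
        Fin (k + 2) → BasicFraenkelModel A) := by
  obtain ⟨E, hE, hx⟩ := exists_supports x
  obtain ⟨F, hF, hp⟩ := exists_common_support p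
  choose! g hg hg' using hφ
  let S : Set (BasicFraenkelModel A) := {w | ∃ z, z ∈ₐ x ∧ φ.Realize
      (Fin.cons z (Fin.cons w p : Fin (k + 1) → BasicFraenkelModel A) :
        Fin (k + 2) → BasicFraenkelModel A)}
  -- By uniqueness the values form the image of a small class under `g`.
  have : Small.{u} S := by
    refine small_subset (s := Set.range fun z : elements x => g z.1) (t := S) ?_
    rintro w ⟨z, hz, hw⟩
    exact ⟨⟨z, hz⟩, (hg' z hz w hw).symm⟩
  obtain ⟨y, hy, h, -⟩ := exists_set S (hE.union hF) fun π hπ w ⟨z, hz, hw⟩ =>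
    ⟨π • z, hx.smul_mem (fun a ha => hπ a (Or.inl ha)) hz,
      (realize_cons_cons_of_supports φ
        (fun i => hp i π fun a ha => hπ a (Or.inr ha)) z w).2 hw⟩
  exact ⟨y, hy, h⟩

/-! ### Natural numbers -/

/-- The von Neumann numerals of the model. -/
noncomputable def num : ℕ → BasicFraenkelModel A
  | 0 => exists_isEmptySet.choose
  | k + 1 => (exists_isSuccessor (num k)).choose

theorem isEmptySet_num_zero : IsEmptySet (num 0 : BasicFraenkelModel A) :=
  exists_isEmptySet.choose_spec

theorem isSuccessor_num (k : ℕ) : IsSuccessor (num (k + 1) : BasicFraenkelModel A) (num k) :=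
  (exists_isSuccessor (num k)).choose_spec

theorem isSet_num (k : ℕ) : IsSet (num k : BasicFraenkelModel A) := by
  cases k with
  | zero => exact isEmptySet_num_zero.1
  | succ k => exact (isSuccessor_num k).1

theorem eq_num_zero_of_isEmptySet {x : BasicFraenkelModel A} (h : IsEmptySet x) : x = num 0 :=
  ext_of_isSet h.1 (isSet_num 0) fun z => iff_of_false (h.2 z) (isEmptySet_num_zero.2 z)

theorem eq_num_of_isSuccessor {x : BasicFraenkelModel A} {k : ℕ} (h : IsSuccessor x (num k)) :
    x = num (k + 1) :=
  ext_of_isSet h.1 (isSet_num _) fun z => (h.2 z).trans ((isSuccessor_num k).2 z).symm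

theorem mem_num_iff {k : ℕ} {x : BasicFraenkelModel A} :
    x ∈ₐ num k ↔ ∃ j < k, x = num j := by
  induction k with
  | zero => exact iff_of_false (isEmptySet_num_zero.2 x) (by simp)
  | succ k ih =>
    rw [(isSuccessor_num k).2, ih]
    constructor
    · rintro (⟨j, hj, rfl⟩ | rfl)
      · exact ⟨j, by omega, rfl⟩
      · exact ⟨k, by omega, rfl⟩
    · rintro ⟨j, hj, rfl⟩
      rcases Nat.lt_succ_iff_lt_or_eq.1 hj with hj | rfl
      · exact Or.inl ⟨j, hj, rfl⟩
      · exact Or.inr rfl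

theorem not_mem_self (x : BasicFraenkelModel A) : ¬ x ∈ₐ x :=
  wellFounded_mem.irrefl.irrefl x

theorem num_injective : Function.Injective (num : ℕ → BasicFraenkelModel A) := by
  intro j k h
  by_contra hjk
  rcases Nat.lt_or_gt_of_ne hjk with hjk | hjk
  · exact not_mem_self (num k) (mem_num_iff.2 ⟨j, hjk, h.symm⟩)
  · exact not_mem_self (num j) (mem_num_iff.2 ⟨k, hjk, h⟩)

theorem num_mem_num_iff {j k : ℕ} : (num j : BasicFraenkelModel A) ∈ₐ num k ↔ j < k := by
  rw [mem_num_iff]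
  exact ⟨by rintro ⟨i, hi, h⟩; rwa [num_injective h], fun h => ⟨j, h, rfl⟩⟩

@[simp]
theorem smul_num (π : Equiv.Perm A) (k : ℕ) : π • (num k : BasicFraenkelModel A) = num k := by
  induction k with
  | zero =>
    exact eq_num_zero_of_isEmptySet ⟨(isSet_smul_iff π).2 (isSet_num 0), fun z hz =>
      isEmptySet_num_zero.2 _ ((mem_smul_iff π).1 hz)⟩
  | succ k ih =>
    refine eq_num_of_isSuccessor ⟨(isSet_smul_iff π).2 (isSet_num _), fun z => ?_⟩
    rw [mem_smul_iff, (isSuccessor_num k).2, ← mem_smul_iff, ih, inv_smul_eq_iff, ih]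

theorem isNumeral_iff {k : ℕ} {n : BasicFraenkelModel A} : IsNumeral k n ↔ n = num k := by
  induction k generalizing n with
  | zero => exact ⟨eq_num_zero_of_isEmptySet, fun h => h ▸ isEmptySet_num_zero⟩
  | succ k ih =>
    constructor
    · rintro ⟨m, hm, h⟩
      rw [ih.1 hm] at h
      exact eq_num_of_isSuccessor h
    · rintro rfl
      exact ⟨num k, ih.2 rfl, isSuccessor_num k⟩

theorem exists_omega : ∃ I : BasicFraenkelModel A, ∀ z, z ∈ₐ I ↔ ∃ k, z = num k := by
  have : Small.{u} ℕ := inferInstance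
  obtain ⟨I, -, h, -⟩ := exists_set (Set.range (num : ℕ → BasicFraenkelModel A))
    Set.finite_empty fun π _ z ⟨k, hk⟩ => ⟨k, by rw [← hk, smul_num]⟩
  exact ⟨I, fun z => (h z).trans (exists_congr fun _ => eq_comm)⟩

theorem isInductive_of_omega {I : BasicFraenkelModel A} (h : ∀ z, z ∈ₐ I ↔ ∃ k, z = num k) :
    IsInductive I := by
  refine ⟨⟨num 0, (h _).2 ⟨0, rfl⟩, isEmptySet_num_zero⟩, fun x hx => ?_⟩
  obtain ⟨k, rfl⟩ := (h x).1 hx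
  exact ⟨num (k + 1), (h _).2 ⟨_, rfl⟩, isSuccessor_num k⟩

/-- The class of numerals is a set of the model, with empty support, and it is inductive; so no
nonstandard naturals occur. -/
theorem isNatural_iff {n : BasicFraenkelModel A} : IsNatural n ↔ ∃ k, n = num k := by
  constructor
  · intro hn
    obtain ⟨I, hI⟩ := exists_omega (A := A)
    exact (hI n).1 (hn I (isInductive_of_omega hI))
  · rintro ⟨k, rfl⟩ I ⟨⟨e, heI, he⟩, hI⟩
    induction k with
    | zero => rwa [← eq_num_zero_of_isEmptySet he]
    | succ k ih =>
      obtain ⟨y, hyI, hy⟩ := hI _ ih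
      rwa [← eq_num_of_isSuccessor hy]

theorem modelsZFA : ModelsZFA (BasicFraenkelModel A) where
  empty := exists_isEmptySet
  atoms a ha z hz := mem_isSet hz ha
  extensionality _ _ := ext_of_isSet
  regularity x hx := by
    obtain ⟨y, hy, h⟩ := wellFounded_mem.has_min (elements x) hx
    exact ⟨y, hy, h⟩
  pairing := exists_isUnorderedPair
  union := exists_isUnion
  powerSet := exists_isPowerSet
  infinity := by
    obtain ⟨I, hI⟩ := exists_omega (A := A)
    exact ⟨I, isInductive_of_omega hI⟩
  separation _ := exists_separation
  replacement _ := exists_replacement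

/-! ### Ordered pairs and functions -/

theorem isUnorderedPair_eq_iff {p q x y z w : BasicFraenkelModel A} (hp : IsUnorderedPair p x y)
    (hq : IsUnorderedPair q z w) : p = q ↔ ({x, y} : Set (BasicFraenkelModel A)) = {z, w} := by
  constructor
  · rintro rfl
    exact Set.ext fun v => (hp.2 v).symm.trans (hq.2 v)
  · intro h
    exact ext_of_isSet hp.1 hq.1 fun v =>
      (hp.2 v).trans ((Set.ext_iff.1 h v).trans (hq.2 v).symm)

theorem exists_isOrderedPair (x y : BasicFraenkelModel A) : ∃ p, IsOrderedPair p x y := by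
  obtain ⟨a, ha⟩ := exists_isUnorderedPair x x
  obtain ⟨b, hb⟩ := exists_isUnorderedPair x y
  obtain ⟨p, hp⟩ := exists_isUnorderedPair a b
  exact ⟨p, a, b, ha, hb, hp⟩

/-- The ordered pair in the model. -/
noncomputable def opair (x y : BasicFraenkelModel A) : BasicFraenkelModel A :=
  (exists_isOrderedPair x y).choose

theorem isOrderedPair_opair (x y : BasicFraenkelModel A) : IsOrderedPair (opair x y) x y :=
  (exists_isOrderedPair x y).choose_spec

theorem isOrderedPair_iff {p x y : BasicFraenkelModel A} :
    IsOrderedPair p x y ↔ p = opair x y := by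
  constructor
  · rintro ⟨a, b, ha, hb, hp⟩
    obtain ⟨a', b', ha', hb', hp'⟩ := isOrderedPair_opair x y
    rw [isUnorderedPair_eq_iff hp hp', (isUnorderedPair_eq_iff ha ha').2 rfl,
      (isUnorderedPair_eq_iff hb hb').2 rfl]
  · rintro rfl
    exact isOrderedPair_opair x y

theorem opair_inj {x y z w : BasicFraenkelModel A} :
    opair x y = opair z w ↔ x = z ∧ y = w := by
  refine ⟨fun h => ?_, by rintro ⟨rfl, rfl⟩; rfl⟩
  obtain ⟨a, b, ha, hb, hp⟩ := isOrderedPair_opair x y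
  obtain ⟨c, d, hc, hd, hq⟩ := isOrderedPair_opair z w
  have h := (isUnorderedPair_eq_iff hp hq).1 h
  simp only [Set.pair_eq_pair_iff, isUnorderedPair_eq_iff ha hc, isUnorderedPair_eq_iff ha hd,
    isUnorderedPair_eq_iff hb hc, isUnorderedPair_eq_iff hb hd] at h
  grind

theorem isUnorderedPair_smul {p x y : BasicFraenkelModel A} (h : IsUnorderedPair p x y)
    (π : Equiv.Perm A) : IsUnorderedPair (π • p) (π • x) (π • y) := by
  refine ⟨(isSet_smul_iff π).2 h.1, fun z => ?_⟩
  rw [mem_smul_iff, h.2, inv_smul_eq_iff, inv_smul_eq_iff]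

theorem smul_opair (π : Equiv.Perm A) (x y : BasicFraenkelModel A) :
    π • opair x y = opair (π • x) (π • y) := by
  obtain ⟨a, b, ha, hb, hp⟩ := isOrderedPair_opair x y
  exact isOrderedPair_iff.1 ⟨_, _, isUnorderedPair_smul ha π, isUnorderedPair_smul hb π,
    isUnorderedPair_smul hp π⟩

theorem mapsTo_iff {f x y : BasicFraenkelModel A} : MapsTo f x y ↔ opair x y ∈ₐ f := by
  simp only [MapsTo, isOrderedPair_iff, exists_eq_right]

/-- A function given by its graph. -/
theorem isFunction_of_graph {f a b : BasicFraenkelModel A} (hf : IsSet f)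
    {G : BasicFraenkelModel A → BasicFraenkelModel A → Prop}
    (h : ∀ p, p ∈ₐ f ↔ ∃ x y, G x y ∧ p = opair x y) (hG : ∀ x y, G x y → x ∈ₐ a ∧ y ∈ₐ b)
    (hu : ∀ x, x ∈ₐ a → ∃! y, G x y) :
    IsFunction f a b ∧ ∀ x y, MapsTo f x y ↔ G x y := by
  have hm : ∀ x y, MapsTo f x y ↔ G x y := fun x y => by
    rw [mapsTo_iff, h]
    constructor
    · rintro ⟨x', y', hG', e⟩
      obtain ⟨rfl, rfl⟩ := opair_inj.1 e
      exact hG'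
    · exact fun h => ⟨x, y, h, rfl⟩
  refine ⟨⟨hf, fun p hp => ?_, fun x hx => ?_⟩, hm⟩
  · obtain ⟨x, y, hxy, rfl⟩ := (h p).1 hp
    exact ⟨x, y, (hG x y hxy).1, (hG x y hxy).2, isOrderedPair_opair x y⟩
  · simp only [hm]
    exact hu x hx

/-! ### Cardinality -/

theorem elements_num (k : ℕ) :
    elements (num k : BasicFraenkelModel A) = num '' Set.Iio k :=
  Set.ext fun _ => mem_num_iff.trans
    ⟨fun ⟨j, hj, h⟩ => ⟨j, hj, h.symm⟩, fun ⟨j, hj, h⟩ => ⟨j, hj, h.symm⟩⟩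

theorem encard_elements_num (k : ℕ) :
    (elements (num k : BasicFraenkelModel A)).encard = k := by
  rw [elements_num, num_injective.encard_image, ← Finset.coe_Iio,
    Set.encard_coe_eq_coe_finsetCard, Nat.card_Iio]

/-- Absoluteness: the graph of an external bijection between finite sets is a finite class, hence
belongs to the model. -/
theorem hasCard_num_iff {x : BasicFraenkelModel A} {k : ℕ} :
    HasCard x (num k) ↔ IsSet x ∧ (elements x).encard = k := by
  refine and_congr_right fun hx => ⟨?_, fun h => ?_⟩
  · rintro ⟨f, ⟨hf, hfp, hfu⟩, hfb⟩
    choose! g hg hgu using hfu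
    have hmaps : ∀ i w, MapsTo f i w → i ∈ₐ num k ∧ w ∈ₐ x := by
      intro i w hiw
      obtain ⟨i', w', hi, hw, e⟩ := hfp _ (mapsTo_iff.1 hiw)
      obtain ⟨rfl, rfl⟩ := opair_inj.1 (isOrderedPair_iff.1 e)
      exact ⟨hi, hw⟩
    have hb : Set.BijOn g (elements (num k)) (elements x) := by
      refine ⟨fun i hi => (hmaps _ _ (hg i hi)).2, fun i hi j hj hij => ?_, fun w hw => ?_⟩
      · have hi' := hg i hi
        have hj' := hg j hj
        rw [← hij] at hj'
        exact (hfb (g i) (hmaps _ _ hi').2).unique hi' hj'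
      · obtain ⟨i, hi, -⟩ := hfb w hw
        exact ⟨i, (hmaps _ _ hi).1, (hgu i (hmaps _ _ hi).1 w hi).symm⟩
    rw [← hb.image_eq, hb.injOn.encard_image, encard_elements_num]
  · have hfin : (elements (num k : BasicFraenkelModel A)).Finite :=
      Set.finite_of_encard_eq_coe (encard_elements_num k)
    obtain ⟨g, hb⟩ := hfin.exists_bijOn_of_encard_eq ((encard_elements_num k).trans h.symm)
    obtain ⟨f, hf, hfG⟩ := exists_set_of_finite
      ((fun i => opair i (g i)) '' elements (num k)) (hfin.image _)
    have hfG' : ∀ p, p ∈ₐ f ↔ ∃ i w, (i ∈ₐ num k ∧ w = g i) ∧ p = opair i w := by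
      refine fun p => (hfG p).trans ⟨?_, ?_⟩
      · rintro ⟨i, hi, rfl⟩
        exact ⟨i, _, ⟨hi, rfl⟩, rfl⟩
      · rintro ⟨i, w, ⟨hi, rfl⟩, rfl⟩
        exact ⟨i, hi, rfl⟩
    obtain ⟨hfun, hm⟩ := isFunction_of_graph (a := num k) (b := x) hf hfG'
      (fun i w h => ⟨h.1, h.2 ▸ hb.mapsTo h.1⟩) fun i hi => ⟨g i, ⟨hi, rfl⟩, fun w h => h.2⟩
    refine ⟨f, hfun, fun w hw => ?_⟩
    obtain ⟨i, hi, rfl⟩ := hb.surjOn hw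
    exact ⟨i, (hm _ _).2 ⟨hi, rfl⟩, fun j hj =>
      hb.injOn ((hm _ _).1 hj).1 hi ((hm _ _).1 hj).2.symm⟩

theorem isFinite_iff {x : BasicFraenkelModel A} :
    IsFinite x ↔ IsSet x ∧ (elements x).Finite := by
  refine and_congr_right fun hx => ⟨?_, fun h => ?_⟩
  · rintro ⟨n, hn, h⟩
    obtain ⟨k, rfl⟩ := isNatural_iff.1 hn
    exact Set.finite_of_encard_eq_coe (hasCard_num_iff.1 h).2
  · exact ⟨num (elements x).ncard, isNatural_iff.2 ⟨_, rfl⟩,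
      hasCard_num_iff.2 ⟨hx, h.cast_ncard_eq.symm⟩⟩

theorem isInfinite_iff {x : BasicFraenkelModel A} :
    IsInfinite x ↔ IsSet x ∧ (elements x).Infinite := by
  rw [IsInfinite, isFinite_iff, not_and]
  exact and_congr_right fun hx => ⟨fun h => h hx, fun h _ => h⟩

theorem isFiniteWithCardGT_num_iff {x : BasicFraenkelModel A} {k : ℕ} :
    IsFiniteWithCardGT x (num k) ↔
      IsSet x ∧ (elements x).Finite ∧ k < (elements x).ncard := by
  constructor
  · rintro ⟨m, hm, hkm, h⟩
    obtain ⟨m, rfl⟩ := isNatural_iff.1 hm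
    obtain ⟨hx, hc⟩ := hasCard_num_iff.1 h
    refine ⟨hx, Set.finite_of_encard_eq_coe hc, ?_⟩
    rw [Set.ncard, hc]
    exact num_mem_num_iff.1 hkm
  · rintro ⟨hx, hfin, hk⟩
    exact ⟨num _, isNatural_iff.2 ⟨_, rfl⟩, num_mem_num_iff.2 hk,
      hasCard_num_iff.2 ⟨hx, hfin.cast_ncard_eq.symm⟩⟩

theorem hasCard_smul {x : BasicFraenkelModel A} {k : ℕ} (h : HasCard x (num k))
    (π : Equiv.Perm A) : HasCard (π • x) (num k) := by
  rw [hasCard_num_iff] at h ⊢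
  rwa [isSet_smul_iff, elements_smul, (MulAction.injective π).encard_image]

/-! ### Least supports -/

theorem swap_fixes [DecidableEq A] {E : Set A} {a b : A} (ha : a ∉ E) (hb : b ∉ E) :
    ∀ e ∈ E, Equiv.swap a b e = e := fun _ he =>
  Equiv.swap_apply_of_ne_of_ne (ne_of_mem_of_not_mem he ha) (ne_of_mem_of_not_mem he hb)

-- If `π` fixes `S \ {a}` but moves `a` to `c`, then `c ∉ S`. For a fresh `b`, the swap `(a b)`
-- fixes `x` because of `T`, and `(b c)` because of `S`. The product `(a b)(b c)π` sends `a → c → b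
-- → a` and fixes `S` pointwise, so it fixes `x`; hence so does `π`.
open Classical in
theorem Supports.diff_singleton [Infinite A] {S T : Set A} {x : BasicFraenkelModel A} {a : A}
    (hS : S.Finite) (hT : T.Finite) (hSx : Supports S x) (hTx : Supports T x) (haT : a ∉ T) :
    Supports (S \ {a}) x := by
  intro π hπ
  by_cases hc : ∀ s ∈ S, π s = s
  · exact hSx π hc
  obtain ⟨b, hb⟩ := (hS.union hT).exists_notMem
  have hbS : b ∉ S := fun h => hb (Or.inl h)
  have hbT : b ∉ T := fun h => hb (Or.inr h)
  have hca : π a ≠ a := fun h => hc fun s hs => by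
    by_cases hsa : s = a
    · rw [hsa, h]
    · exact hπ s ⟨hs, hsa⟩
  have hcS : π a ∉ S := fun h => hca (π.injective (hπ _ ⟨h, hca⟩))
  have h1 : Equiv.swap a b • x = x := hTx _ (swap_fixes haT hbT)
  have h2 : Equiv.swap b (π a) • x = x := hSx _ (swap_fixes hbS hcS)
  have h3 : (Equiv.swap a b * Equiv.swap b (π a) * π) • x = x := hSx _ fun s hs => by
    by_cases hsa : s = a
    · simp [hsa]
    · rw [Equiv.Perm.mul_apply, Equiv.Perm.mul_apply, hπ s ⟨hs, hsa⟩,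
        swap_fixes hbS hcS s hs,
        Equiv.swap_apply_of_ne_of_ne hsa (ne_of_mem_of_not_mem hs hbS)]
  rw [mul_smul, mul_smul] at h3
  refine MulAction.injective (Equiv.swap b (π a)) (MulAction.injective (Equiv.swap a b) ?_)
  exact h3.trans ((congrArg _ h2).trans h1).symm

/-- A finite support of minimal size is least: an atom missing from another finite support could be
removed from it. -/
theorem exists_least_supports [Infinite A] (x : BasicFraenkelModel A) :
    ∃ S : Set A, S.Finite ∧ Supports S x ∧ ∀ T : Set A, T.Finite → Supports T x → S ⊆ T := by
  classical
  let P : ℕ → Prop := fun k => ∃ S : Set A, S.Finite ∧ Supports S x ∧ S.ncard = k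
  have hP : ∃ k, P k := by
    obtain ⟨S, hS, hx⟩ := exists_supports x
    exact ⟨_, S, hS, hx, rfl⟩
  obtain ⟨S, hS, hx, hk⟩ := Nat.find_spec hP
  refine ⟨S, hS, hx, fun T hT hTx a ha => ?_⟩
  by_contra haT
  refine Nat.find_min hP (m := (S \ {a}).ncard) ?_
    ⟨_, hS.sdiff, hx.diff_singleton hS hT hTx haT, rfl⟩
  rw [← hk]
  exact Set.ncard_sdiff_singleton_lt_of_mem ha hS

/-- The least finite support of an element of the model. -/
noncomputable def supp [Infinite A] (x : BasicFraenkelModel A) : Set A :=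
  (exists_least_supports x).choose

theorem finite_supp [Infinite A] (x : BasicFraenkelModel A) : (supp x).Finite :=
  (exists_least_supports x).choose_spec.1

theorem supports_supp [Infinite A] (x : BasicFraenkelModel A) : Supports (supp x) x :=
  (exists_least_supports x).choose_spec.2.1

theorem Supports.supp_subset [Infinite A] {x : BasicFraenkelModel A} {T : Set A}
    (h : Supports T x) (hT : T.Finite) : supp x ⊆ T :=
  (exists_least_supports x).choose_spec.2.2 T hT h

/-- The preimage of the least support under `π` supports `π⁻¹ • x = x`, so it contains the least
support. -/
theorem apply_mem_supp [Infinite A] {x : BasicFraenkelModel A} {π : Equiv.Perm A}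
    (h : π • x = x) {a : A} (ha : a ∈ supp x) : π a ∈ supp x := by
  have h1 : Supports (⇑π⁻¹ '' supp x) x := by
    have := (supports_supp x).smul π⁻¹
    rwa [inv_smul_eq_iff.2 h.symm] at this
  obtain ⟨b, hb, hba⟩ := h1.supp_subset ((finite_supp x).image _) ha
  rwa [← hba, ← Equiv.Perm.mul_apply, mul_inv_cancel, Equiv.Perm.one_apply]

-- If `b ≠ c` gave the same image, `(a c)(a b)` would fix `x` while sending `a` out of the least
-- support to `b`. This is the source of infinite orbits.
open Classical in
theorem injOn_swap_smul [Infinite A] {x : BasicFraenkelModel A} {a : A} (ha : a ∈ supp x) :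
    Set.InjOn (fun b => Equiv.swap a b • x) (supp x)ᶜ := by
  intro b hb c hc h
  by_contra hbc
  have h' : (Equiv.swap a c * Equiv.swap a b) • x = x := by
    rw [mul_smul]
    exact (congrArg _ h).trans (by rw [← mul_smul, Equiv.swap_mul_self, one_smul])
  have := apply_mem_supp h' ha
  rw [Equiv.Perm.mul_apply, Equiv.swap_apply_left,
    Equiv.swap_apply_of_ne_of_ne (ne_of_mem_of_not_mem ha hb).symm hbc] at this
  exact hb this

/-- The elements of a finite set are supported by the supports of the set. -/
theorem Supports.of_mem [Infinite A] {z w : BasicFraenkelModel A} {E : Set A}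
    (hz : Supports E z) (hE : E.Finite) (hfin : (elements z).Finite) (hw : w ∈ₐ z) :
    Supports E w := by
  classical
  refine (supports_supp w).mono fun a ha => ?_
  by_contra haE
  -- Swapping `a` with fresh atoms fixes `z`, so it would produce infinitely many elements of the
  -- finite set `z`.
  have hinf : (E ∪ supp w)ᶜ.Infinite := (hE.union (finite_supp w)).infinite_compl
  refine hinf (Set.Finite.of_finite_image (f := fun b => Equiv.swap a b • w)
    (hfin.subset ?_) ((injOn_swap_smul ha).mono fun b hb h => hb (Or.inr h)))
  rintro _ ⟨b, hb, rfl⟩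
  exact hz.smul_mem (swap_fixes haE fun h => hb (Or.inl h)) hw

/-! ### Partial choice -/

/-- If an equivariant relation relates every element of the infinite set `F` to something that
has no larger support, then it is uniformized by a function on an infinite subset of `F`. -/
theorem exists_partial_uniformization [Infinite A] {F : BasicFraenkelModel A}
    (hF : (elements F).Infinite) {P : BasicFraenkelModel A → BasicFraenkelModel A → Prop}
    (hP : ∀ (π : Equiv.Perm A) z w, P z w → P (π • z) (π • w))
    (h : ∀ z, z ∈ₐ F → ∃ w, P z w ∧ ∀ E : Set A, E.Finite → Supports E z → Supports E w) :
    ∃ B : BasicFraenkelModel A, IsSubset B F ∧ IsInfinite B ∧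
      ∃ f : BasicFraenkelModel A, ∀ R : BasicFraenkelModel A,
        (∀ z w, z ∈ₐ B → P z w → w ∈ₐ R) → IsFunction f B R ∧ ∀ z w, MapsTo f z w → P z w := by
  classical
  obtain ⟨E, hE, hEF⟩ := exists_supports F
  choose! g hg hgs using h
  -- It is enough to find a finitely supported functional relation inside `P` with infinite domain:
  -- comprehension turns its domain and graph into `B` and `f`.
  suffices H : ∃ E' : Set A, E'.Finite ∧ ∃ G : BasicFraenkelModel A → BasicFraenkelModel A → Prop,
      (∀ π : Equiv.Perm A, (∀ a ∈ E', π a = a) → ∀ z w, G z w → G (π • z) (π • w)) ∧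
      (∀ z w, G z w → z ∈ₐ F ∧ P z w) ∧ (∀ z w w', G z w → G z w' → w = w') ∧
      {z | ∃ w, G z w}.Infinite by
    obtain ⟨E', hE', G, hGs, hGP, hGu, hGi⟩ := H
    choose! v hv using fun z (hz : ∃ w, G z w) => hz
    have hsmall : Small.{u} {z | ∃ w, G z w} :=
      small_subset (s := elements F) fun z ⟨w, hw⟩ => (hGP z w hw).1
    have hsmall' : Small.{u} {p | ∃ z w, G z w ∧ p = opair z w} := by
      refine small_subset
        (s := Set.range fun z : {z | ∃ w, G z w} => opair z.1 (v z.1)) ?_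
      rintro _ ⟨z, w, hzw, rfl⟩
      exact ⟨⟨z, w, hzw⟩, congrArg _ (hGu _ _ _ (hv z ⟨w, hzw⟩) hzw)⟩
    obtain ⟨B, hB, hBG, -⟩ := exists_set {z | ∃ w, G z w} hE' fun π hπ z ⟨w, hw⟩ =>
      ⟨π • w, hGs π hπ z w hw⟩
    obtain ⟨f, hf, hfG, -⟩ := exists_set {p | ∃ z w, G z w ∧ p = opair z w} hE'
      fun π hπ p ⟨z, w, hw, e⟩ => ⟨π • z, π • w, hGs π hπ z w hw, by rw [e, smul_opair]⟩
    refine ⟨B, ⟨hB, fun z hz => ?_⟩, isInfinite_iff.2 ⟨hB, ?_⟩, f, fun R hR => ?_⟩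
    · obtain ⟨w, hw⟩ := (hBG z).1 hz
      exact (hGP z w hw).1
    · rwa [show elements B = {z | ∃ w, G z w} from Set.ext hBG]
    · obtain ⟨hfun, hm⟩ := isFunction_of_graph (a := B) (b := R) hf hfG
        (fun z w hzw => have hz := (hBG z).2 ⟨w, hzw⟩; ⟨hz, hR z w hz (hGP z w hzw).2⟩)
        fun z hz => by
          obtain ⟨w, hw⟩ := (hBG z).1 hz
          exact ⟨w, hw, fun w' hw' => hGu _ _ _ hw' hw⟩
      exact ⟨hfun, fun z w hzw => (hGP z w ((hm z w).1 hzw)).2⟩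
  -- Here the arbitrary choice `g` is symmetric, as `z` and `g z` are both fixed by the permutations
  -- in question.
  by_cases hF1 : {z | z ∈ₐ F ∧ Supports E z}.Infinite
  · refine ⟨E, hE, fun z w => (z ∈ₐ F ∧ Supports E z) ∧ w = g z, ?_, ?_, ?_, ?_⟩
    · rintro π hπ z w ⟨hz, rfl⟩
      rw [hz.2 π hπ, hgs z hz.1 E hE hz.2 π hπ]
      exact ⟨hz, rfl⟩
    · rintro z w ⟨hz, rfl⟩
      exact ⟨hz.1, hg z hz.1⟩
    · rintro z w w' ⟨-, rfl⟩ ⟨-, rfl⟩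
      rfl
    · refine hF1.mono fun z hz => ⟨g z, hz, rfl⟩
  obtain ⟨z, hz, hzE⟩ : ∃ z, z ∈ₐ F ∧ ¬ Supports E z := by
    by_contra! hcon
    exact hF1 (hF.mono fun z hz => ⟨hz, hcon z hz⟩)
  obtain ⟨a, ha, haE⟩ : ∃ a ∈ supp z, a ∉ E := by
    by_contra! hcon
    exact hzE ((supports_supp z).mono hcon)
  -- Such a `π` maps the least support into itself and fixes all of it except possibly `a`;
  -- injectivity leaves `a` no other image.
  have hfix : ∀ π : Equiv.Perm A, (∀ e ∈ E ∪ (supp z \ {a}), π e = e) → π • z = z →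
      π • g z = g z := by
    intro π hπ hπz
    refine hgs z hz _ (finite_supp z) (supports_supp z) π fun s hs => ?_
    by_cases hsa : s = a
    · subst hsa
      by_contra hne
      exact hne (π.injective (hπ _ (Or.inr ⟨apply_mem_supp hπz hs, hne⟩)))
    · exact hπ s (Or.inr ⟨hs, hsa⟩)
  refine ⟨E ∪ (supp z \ {a}), hE.union (finite_supp z).sdiff, fun y w =>
    ∃ π : Equiv.Perm A, (∀ e ∈ E ∪ (supp z \ {a}), π e = e) ∧ y = π • z ∧ w = π • g z,
    ?_, ?_, ?_, ?_⟩
  · rintro σ hσ y w ⟨π, hπ, rfl, rfl⟩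
    exact ⟨σ * π, fun e he => by rw [Equiv.Perm.mul_apply, hπ e he, hσ e he],
      (mul_smul _ _ _).symm, (mul_smul _ _ _).symm⟩
  · rintro y w ⟨π, hπ, rfl, rfl⟩
    exact ⟨hEF.smul_mem (fun e he => hπ e (Or.inl he)) hz, hP π _ _ (hg z hz)⟩
  · rintro y w w' ⟨π, hπ, rfl, rfl⟩ ⟨σ, hσ, hy, rfl⟩
    have := hfix (σ⁻¹ * π)
      (fun e he => by rw [Equiv.Perm.mul_apply, hπ e he, inv_fixes hσ e he])
      (by rw [mul_smul, hy, inv_smul_smul])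
    rwa [mul_smul, inv_smul_eq_iff] at this
  · have hinf : (E ∪ supp z)ᶜ.Infinite := (hE.union (finite_supp z)).infinite_compl
    refine (hinf.image (f := fun b => Equiv.swap a b • z)
      ((injOn_swap_smul ha).mono (Set.compl_subset_compl.2 Set.subset_union_right))).mono ?_
    rintro _ ⟨b, hb, rfl⟩
    refine ⟨_, Equiv.swap a b, swap_fixes ?_ ?_, rfl, rfl⟩
    · rintro (h | h)
      exacts [haE h, h.2 rfl]
    · rintro (h | h)
      exacts [hb (Or.inl h), hb (Or.inr h.1)]

/-- The relation to uniformize is membership. The codomain `⋃ B` is formed only once `B` is known.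
-/
theorem acfMinus [Infinite A] : ACFMinus (BasicFraenkelModel A) := by
  intro F hF hFf
  obtain ⟨B, hBF, hBi, f, hf⟩ := exists_partial_uniformization (isInfinite_iff.1 hF).2
    (P := fun z w => w ∈ₐ z) (fun π z w h => (smul_mem_smul_iff π).2 h) fun z hz => by
      obtain ⟨hfin, w, hw⟩ := hFf z hz
      exact ⟨w, hw, fun E hE hEz => hEz.of_mem hE (isFinite_iff.1 hfin).2 hw⟩
  obtain ⟨U, hU⟩ := exists_isUnion B
  obtain ⟨hfun, hm⟩ := hf U fun z w hz hw => (hU.2 w).2 ⟨z, hz, hw⟩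
  exact ⟨B, hBF, hBi, U, f, hU, hfun, hm⟩

theorem cFinMinus [Infinite A] {n : BasicFraenkelModel A} (hn : IsNatural n) :
    CFinMinus (BasicFraenkelModel A) n := by
  obtain ⟨k, rfl⟩ := isNatural_iff.1 hn
  intro F hF hFf
  obtain ⟨B, hBF, hBi, f, hf⟩ := exists_partial_uniformization (isInfinite_iff.1 hF).2
    (P := fun z w => IsSubset w z ∧ HasCard w (num k))
    (fun π z w h => ⟨(isSubset_smul_iff π).2 h.1, hasCard_smul h.2 π⟩) fun z hz => by
      obtain ⟨-, hfin, hk⟩ := isFiniteWithCardGT_num_iff.1 (hFf z hz)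
      obtain ⟨S, hSz, hS⟩ := Set.exists_subset_encard_eq (s := elements z) (k := k)
        (by rw [← hfin.cast_ncard_eq]; exact_mod_cast hk.le)
      obtain ⟨w, hw, hwS⟩ := exists_set_of_finite S (hfin.subset hSz)
      have e : elements w = S := Set.ext hwS
      refine ⟨w, ⟨⟨hw, fun v hv => hSz ((hwS v).1 hv)⟩, hasCard_num_iff.2 ⟨hw, e ▸ hS⟩⟩,
        fun E hE hEz π hπ => ext_of_isSet ((isSet_smul_iff π).2 hw) hw fun v => ?_⟩
      -- A support of the finite set `z` fixes each of its elements, so any subset of `z` is fixed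
      -- as well.
      have hfix : ∀ v ∈ S, π • v = v := fun v hv => hEz.of_mem hE hfin (hSz hv) π hπ
      rw [mem_smul_iff, hwS, hwS]
      constructor
      · intro hv
        have := hfix _ hv
        rw [smul_inv_smul] at this
        rwa [this]
      · intro hv
        rwa [inv_smul_eq_iff.2 (hfix v hv).symm]
  obtain ⟨U, hU⟩ := exists_isUnion B
  obtain ⟨R, hR, hRU⟩ := exists_set_of_subsets U (Q := fun z => HasCard z (num k))
    fun π z hz => hasCard_smul hz π
  obtain ⟨hfun, hm⟩ := hf R fun z w hz hw => (hRU w).2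
    ⟨⟨hw.1.1, fun v hv => (hU.2 v).2 ⟨z, hz, hw.1.2 v hv⟩⟩, hw.2⟩
  exact ⟨B, hBF, hBi, U, R, f, hU, ⟨hR, hRU⟩, hfun, fun z w hzw => (hm z w hzw).1⟩

/-! ### Failure of the Ramsey choice principle at the set of atoms -/

theorem elements_atomSet :
    elements (ZFAStructure.atomSet : BasicFraenkelModel A) = Set.range atom :=
  Set.ext fun z => (isAtom_iff z).trans (exists_congr fun _ => eq_comm)

theorem isInfinite_atomSet [Infinite A] :
    IsInfinite (ZFAStructure.atomSet : BasicFraenkelModel A) := by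
  refine isInfinite_iff.2 ⟨?_, ?_⟩
  · obtain ⟨a⟩ := (inferInstance : Nonempty A)
    exact mem_isSet ((isAtom_iff (atom a)).2 ⟨a, rfl⟩)
  · rw [elements_atomSet]
    exact Set.infinite_range_of_injective atom_injective

theorem not_rcFinAt_atomSet {k : ℕ} (hk : 1 ≤ k) :
    ¬ RCFinAt (num k) (ZFAStructure.atomSet : BasicFraenkelModel A) := by
  classical
  rintro ⟨y, hy, hyi, D, R, f, hD, hR, ⟨hf, hfp, hfu⟩, hfs⟩
  obtain ⟨E, hE, hEf⟩ := exists_supports f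
  -- Size `k + 1` puts `z` in the domain of `f` and forces the `k`-element value to miss a point of
  -- `z`.
  obtain ⟨S, hS, hSfin, hSc⟩ := ((isInfinite_iff.1 hyi).2.sdiff (hE.image atom)).exists_subset_ncard_eq
    (k + 1)
  have hSa : ∀ v ∈ S, ∃ a ∉ E, v = atom a := fun v hv => by
    obtain ⟨a, rfl⟩ := (isAtom_iff v).1 (hy.2 v (hS hv).1)
    exact ⟨a, fun ha => (hS hv).2 ⟨a, ha, rfl⟩, rfl⟩
  obtain ⟨z, hz, hzS⟩ := exists_set_of_finite S hSfin
  have ez : elements z = S := Set.ext hzS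
  have hzD : z ∈ₐ D := (hD.2 z).2 ⟨⟨hz, fun v hv => (hS ((hzS v).1 hv)).1⟩,
    isFiniteWithCardGT_num_iff.2 ⟨hz, ez ▸ hSfin, by rw [ez, hSc]; exact k.lt_succ_self⟩⟩
  obtain ⟨w, hw, hwu⟩ := hfu z hzD
  have hwz := hfs z w hw
  obtain ⟨z', w', -, hwR, e⟩ := hfp _ (mapsTo_iff.1 hw)
  obtain ⟨rfl, rfl⟩ := opair_inj.1 (isOrderedPair_iff.1 e)
  have hwc := (hasCard_num_iff.1 ((hR.2 w).1 hwR).2).2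
  obtain ⟨v, hvw⟩ : (elements w).Nonempty := by
    rw [← Set.encard_ne_zero, hwc]
    exact_mod_cast (by omega : k ≠ 0)
  obtain ⟨t, htS, htw⟩ : ∃ t ∈ S, t ∉ elements w := by
    by_contra! hcon
    have h1 := Set.encard_le_encard (show S ⊆ elements w from hcon)
    rw [hwc, ← hSfin.cast_ncard_eq, hSc] at h1
    have : k + 1 ≤ k := by exact_mod_cast h1
    omega
  have hvS : v ∈ S := (hzS v).1 (hwz.2 v hvw)
  obtain ⟨a, haE, rfl⟩ := hSa v hvS
  obtain ⟨b, hbE, rfl⟩ := hSa t htS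
  have hπ := swap_fixes haE hbE
  have hπS : ∀ v ∈ S, Equiv.swap a b • v ∈ S := fun v hv => by
    obtain ⟨c, -, rfl⟩ := hSa v hv
    rw [smul_atom, Equiv.swap_apply_def]
    split_ifs
    exacts [htS, hvS, hv]
  have hπz : Equiv.swap a b • z = z := by
    refine ext_of_isSet ((isSet_smul_iff _).2 hz) hz fun v => ?_
    rw [mem_smul_iff, Equiv.swap_inv, hzS, hzS]
    refine ⟨fun h => ?_, hπS v⟩
    have := hπS _ h
    rwa [← mul_smul, Equiv.swap_mul_self, one_smul] at this
  -- The swap fixes `f` and `z`, so uniqueness of the value fixes `w`; yet it carries `a`, inside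
  -- `w`, to `b`, outside.
  have hπw : Equiv.swap a b • w = w := by
    refine hwu _ (mapsTo_iff.2 ?_)
    have := hEf.smul_mem hπ (mapsTo_iff.1 hw)
    rwa [smul_opair, hπz] at this
  refine htw ?_
  have := (smul_mem_smul_iff (Equiv.swap a b)).2 (mem_elements.1 hvw)
  rwa [hπw, smul_atom, Equiv.swap_apply_left] at this

theorem not_rcFin [Infinite A] {k : ℕ} (hk : 1 ≤ k) :
    ¬ RCFin (BasicFraenkelModel A) (num k) :=
  fun h => not_rcFinAt_atomSet hk (h _ isInfinite_atomSet)

end BasicFraenkelModel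

theorem mainTheorem10 (A : Type u) [Countable A] [Infinite A] :
    ZFA.ModelsZFA (BasicFraenkelModel A) ∧
    ZFA.ACFMinus (BasicFraenkelModel A) ∧
    (∀ n : BasicFraenkelModel A, ZFA.IsNatural n → ZFA.CFinMinus (BasicFraenkelModel A) n) ∧
    ZFA.IsInfinite (ZFAStructure.atomSet : BasicFraenkelModel A) ∧
    (∀ n : BasicFraenkelModel A, ZFA.IsNatural n → ¬ ZFA.IsEmptySet n →
      ¬ ZFA.RCFinAt n (ZFAStructure.atomSet : BasicFraenkelModel A) ∧
      ¬ ZFA.RCFin (BasicFraenkelModel A) n) ∧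
    (∀ k : ℕ, 1 ≤ k →
      ¬ ∀ (M : Type (u + 1)) [ZFAStructure M], ZFA.ModelsZFA M →
        (∀ m : M, ZFA.IsNatural m → ZFA.CFinMinus M m) →
        ∀ n : M, ZFA.IsNumeral k n → ZFA.RCFin M n) := by
  refine ⟨BasicFraenkelModel.modelsZFA, BasicFraenkelModel.acfMinus,
    fun n hn => BasicFraenkelModel.cFinMinus hn, BasicFraenkelModel.isInfinite_atomSet,
    fun n hn hne => ?_, fun k hk h => ?_⟩
  · obtain ⟨k, rfl⟩ := BasicFraenkelModel.isNatural_iff.1 hn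
    have hk : 1 ≤ k := Nat.one_le_iff_ne_zero.2 fun hk =>
      hne (hk ▸ BasicFraenkelModel.isEmptySet_num_zero)
    exact ⟨BasicFraenkelModel.not_rcFinAt_atomSet hk, BasicFraenkelModel.not_rcFin hk⟩
  · exact BasicFraenkelModel.not_rcFin hk (h (BasicFraenkelModel A)
      BasicFraenkelModel.modelsZFA (fun m hm => BasicFraenkelModel.cFinMinus hm) _
      (BasicFraenkelModel.isNumeral_iff.2 rfl))
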